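/- Let $1\le p<2$ and let $\{X_n,\ n\ge 1\}$ be a sequence of identically distributed real random variables on a probability space $(\Omega,\mathcal F,\mathbb P)$ that is (positively) associated, i.e. for every finite subfamily $(X_{i_1},\dots,X_{i_m})$ and all coordinatewise nondecreasing (Borel) functions $f,g:\mathbb R^m\to\mathbb R$, $$\mathrm{Cov}\big(f(X_{i_1},\dots,X_{i_m}),\,g(X_{i_1},\dots,X_{i_m})\big)\ge 0$$ whenever this covariance is defined. For $u,v>0$ put $$G_{X_k,X_j}(u,v):=\int_{-v}^{v}\int_{-u}^{u}\big[\mathbb P\{X_k>x,\,X_j>y\}-\mathbb P\{X_k>x\}\,\mathbb P\{X_j>y\}\big]\,dx\,dy ,$$ and suppose that $$\sum_{1\le k<j<\infty}(kj)^{-1/p}\,G_{X_k,X_j}\big(k^{1/p},j^{1/p}\big)<\infty .$$ Then $\mathbb E|X_1|^p<\infty$ if and only if $\mathbb E X_1$ exists and is finite and $$\frac{1}{n^{1/p}}\sum_{k=1}^{n}(X_k-\mathbb E X_1)\to 0\quad\text{almost surely.}$$ Moreover, if $n^{-1/p}\sum_{k=1}^{n}(X_k-c)\to 0$ almost surely for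 some finite constant $c$, then $\mathbb E|X_1|^p<\infty$. -/

import Mathlib

open MeasureTheory ProbabilityTheory Filter Topology

/-- A finite family of real random variables `X i` (`i : ι`) is (positively) associated:
`Cov (f (X), g (X)) ≥ 0` for all coordinatewise nondecreasing (Borel) `f` and `g`, whenever the
covariance is defined, i.e. `f (X)`, `g (X)` and `f (X) * g (X)` are integrable. Here `Monotone`
refers to the coordinatewise order of `ι → ℝ`. -/
def IsAssociatedFamily {Ω ι : Type*} [MeasurableSpace Ω] [Fintype ι]
    (X : ι → Ω → ℝ) (μ : Measure Ω) : Prop :=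
  ∀ f g : (ι → ℝ) → ℝ, Monotone f → Monotone g → Measurable f → Measurable g →
    Integrable (fun ω => f (fun i => X i ω)) μ →
    Integrable (fun ω => g (fun i => X i ω)) μ →
    Integrable (fun ω => f (fun i => X i ω) * g (fun i => X i ω)) μ →
    0 ≤ covariance (fun ω => f (fun i => X i ω)) (fun ω => g (fun i => X i ω)) μ

/-- A sequence of real random variables is (positively) associated if every finite subfamily is. -/
def IsAssociatedSeq {Ω : Type*} [MeasurableSpace Ω] (X : ℕ → Ω → ℝ) (μ : Measure Ω) : Prop :=
  ∀ s : Finset ℕ, IsAssociatedFamily (fun i : s => X i) μ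

/-- `P {X > x, Y > y} - P {X > x} * P {Y > y}`. -/
noncomputable def jointTailDiff {Ω : Type*} [MeasurableSpace Ω] (X Y : Ω → ℝ) (μ : Measure Ω)
    (x y : ℝ) : ℝ :=
  μ.real {ω | x < X ω ∧ y < Y ω} - μ.real {ω | x < X ω} * μ.real {ω | y < Y ω}

/-- `G_{X,Y} (u, v)`, the integral of `jointTailDiff X Y` over `|x| ≤ u`, `|y| ≤ v`. -/
noncomputable def truncCov {Ω : Type*} [MeasurableSpace Ω] (X Y : Ω → ℝ) (μ : Measure Ω)
    (u v : ℝ) : ℝ :=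
  ∫ y in (-v)..v, ∫ x in (-u)..u, jointTailDiff X Y μ x y

/-- The covariance condition
`∑_{1 ≤ k < j < ∞} (k j) ^ (-1/p) * G_{X_k, X_j} (k ^ (1/p), j ^ (1/p)) < ∞`,
where the random variable `X_k` (`k ≥ 1`) is the term `X (k - 1)` of the Lean sequence. -/
def CovarianceCondition {Ω : Type*} [MeasurableSpace Ω] (X : ℕ → Ω → ℝ) (μ : Measure Ω)
    (p : ℝ) : Prop :=
  Summable fun q : {q : ℕ × ℕ // q.1 < q.2} =>
    (((q.1.1 + 1 : ℕ) : ℝ) * ((q.1.2 + 1 : ℕ) : ℝ)) ^ (-(1 / p)) *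
      truncCov (X q.1.1) (X q.1.2) μ
        (((q.1.1 + 1 : ℕ) : ℝ) ^ (1 / p)) (((q.1.2 + 1 : ℕ) : ℝ) ^ (1 / p))

/-- `∑_{k=1}^n (X_k - c) / n ^ (1/p) → 0` almost surely, where the random variable `X_k` (`k ≥ 1`)
is the term `X (k - 1)` of the Lean sequence. -/
def SatisfiesSLLN {Ω : Type*} [MeasurableSpace Ω] (X : ℕ → Ω → ℝ) (μ : Measure Ω)
    (p c : ℝ) : Prop :=
  ∀ᵐ ω ∂μ, Tendsto (fun n : ℕ => (∑ k ∈ Finset.range n, (X k ω - c)) / (n : ℝ) ^ (1 / p))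
    atTop (𝓝 0)

/-!
The Marcinkiewicz–Zygmund strong law for associated variables. Write `b k = k ^ (1 / p)` and let
`Y k` be the truncation of `X k` to `[-b k, b k]`. By Hoeffding's formula
(`truncCov_eq_covariance`) the hypothesis says that `∑ Cov (Y k, Y j) / (b k * b j)` converges over
`k < j`.

*Moment implies strong law.* If `E |X|^p < ∞`, then `∑ P (|X k| ≥ b k) < ∞`, so almost surely only
finitely many `X k` differ from `Y k` (`ae_eventually_clamp_eq`); the means of the `Y k` are close
enough to `E X` by dominated convergence (`tendsto_sum_integral_clamp_sub_div`), and
`∑ Var (Y k) / b k ^ 2 < ∞` because `p < 2` (`summable_variance_clamp_div`). Hence the associated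
centred variables `Z k = (Y k - E (Y k)) / b k` have a summable covariance matrix. The
Newman–Wright maximal inequality (`integral_maxPartialSum_sq_le`) gives almost sure convergence of
`∑ Z k` (`ae_exists_tendsto_sum_of_summable_covariance`), and Kronecker's lemma finishes.

*Strong law implies moment.* The strong law forces `X k / b k → 0`. Replace the indicator of
`{X k ≥ b k}` by a Lipschitz ramp `φ k` vanishing for `X k ≤ b k / 2`. Since
`2 * clamp (b k) / b k - φ k` is nondecreasing, association bounds `Cov (φ k, φ j)` by
`4 * Cov (Y k, Y j) / (b k * b j)`, so that `Var (∑ φ k) ≤ C + ∑ E (φ k)`. Almost surely only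
finitely many `φ k` are nonzero, and a second-moment argument
(`summable_integral_of_ae_summable`) yields `∑ E (φ k) < ∞`. The same applies to `-X`, so
`∑ P (|X| ≥ b k) < ∞`, which is `E |X|^p < ∞`.
-/

/-! ### Association -/

section Association

variable {Ω : Type*} [MeasurableSpace Ω] {μ : Measure Ω} {X : ℕ → Ω → ℝ}

/-- Association in a form free of finite index types: test functions live on the whole sequence
and depend on finitely many coordinates. -/
lemma IsAssociatedSeq.covariance_nonneg [IsFiniteMeasure μ] (hX : IsAssociatedSeq X μ)
    {f g : (ℕ → ℝ) → ℝ} {s : Finset ℕ}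
    (hf : Monotone f) (hg : Monotone g) (hfm : Measurable f) (hgm : Measurable g)
    (hfs : DependsOn f (s : Set ℕ)) (hgs : DependsOn g (s : Set ℕ))
    (hfL : MemLp (fun ω => f fun i => X i ω) 2 μ) (hgL : MemLp (fun ω => g fun i => X i ω) 2 μ) :
    0 ≤ cov[fun ω => f fun i => X i ω, fun ω => g fun i => X i ω; μ] := by
  classical
  let e : (s → ℝ) → ℕ → ℝ := fun v i => if h : i ∈ s then v ⟨i, h⟩ else 0
  have he : Monotone e := by
    intro v w h i
    by_cases hi : i ∈ s
    · simpa [e, hi] using h ⟨i, hi⟩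
    · simp [e, hi]
  have hem : Measurable e := by
    refine measurable_pi_lambda _ fun i => ?_
    by_cases hi : i ∈ s
    · simpa [e, hi] using measurable_pi_apply (⟨i, hi⟩ : s)
    · simp [e, hi]
  have key : ∀ {F : (ℕ → ℝ) → ℝ}, DependsOn F (s : Set ℕ) →
      (fun ω => (F ∘ e) fun i : s => X i ω) = fun ω => F fun i => X i ω := by
    intro F hF
    funext ω
    refine hF fun i hi => ?_
    have hi' : i ∈ s := hi
    simp [e, hi']
  have h := hX s (f ∘ e) (g ∘ e) (hf.comp he) (hg.comp he) (hfm.comp hem) (hgm.comp hem)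
  rw [key hfs, key hgs] at h
  refine h (hfL.integrable (by simp)) (hgL.integrable (by simp)) ?_
  have h2 := hfL.integrable_mul hgL
  have e3 : (fun ω => (f ∘ e) (fun i : s => X i ω) * (g ∘ e) (fun i : s => X i ω))
      = (fun ω => f fun i => X i ω) * (fun ω => g fun i => X i ω) := by
    rw [← key hfs, ← key hgs]; rfl
  rw [e3]
  exact h2

lemma IsAssociatedSeq.comp (hX : IsAssociatedSeq X μ) {φ : ℕ → ℝ → ℝ}
    (hφ : ∀ i, Monotone (φ i)) : IsAssociatedSeq (fun i ω => φ i (X i ω)) μ := by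
  intro s f g hf hg hfm hgm h1 h2 h3
  have hΦ : Monotone fun (v : s → ℝ) (i : s) => φ i (v i) := fun v w h i => hφ i (h i)
  have hΦm : Measurable fun (v : s → ℝ) (i : s) => φ i (v i) :=
    measurable_pi_lambda _ fun i => (hφ i).measurable.comp (measurable_pi_apply i)
  exact hX s _ _ (hf.comp hΦ) (hg.comp hΦ) (hfm.comp hΦm) (hgm.comp hΦm) h1 h2 h3

lemma IsAssociatedSeq.neg (hX : IsAssociatedSeq X μ) : IsAssociatedSeq (fun i ω => -X i ω) μ := by
  intro s f g hf hg hfm hgm h1 h2 h3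
  have hn : Antitone fun (v : s → ℝ) (i : s) => -v i := fun v w h i => neg_le_neg (h i)
  have hnm : Measurable fun (v : s → ℝ) (i : s) => -v i :=
    measurable_pi_lambda _ fun i => (measurable_pi_apply i).neg
  have h := hX s (fun v => -f fun i => -v i) (fun v => -g fun i => -v i)
    (fun v w h => neg_le_neg (hf (hn h))) (fun v w h => neg_le_neg (hg (hn h)))
    (hfm.comp hnm).neg (hgm.comp hnm).neg h1.neg h2.neg (by simpa using h3)
  rwa [covariance_fun_neg_left, covariance_fun_neg_right, neg_neg] at h

/-- Covariances of associated variables increase when the functions are replaced by functions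
that dominate them in the sense of monotone differences. -/
lemma IsAssociatedSeq.covariance_le_covariance [IsFiniteMeasure μ] (hX : IsAssociatedSeq X μ)
    {f g F G : ℝ → ℝ} (i j : ℕ) (hf : Monotone f) (hG : Monotone G)
    (hfF : Monotone (F - f)) (hgG : Monotone (G - g))
    (hfL : MemLp (fun ω => f (X i ω)) 2 μ) (hgL : MemLp (fun ω => g (X j ω)) 2 μ)
    (hFL : MemLp (fun ω => F (X i ω)) 2 μ) (hGL : MemLp (fun ω => G (X j ω)) 2 μ) :
    cov[fun ω => f (X i ω), fun ω => g (X j ω); μ]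
      ≤ cov[fun ω => F (X i ω), fun ω => G (X j ω); μ] := by
  have key : ∀ {a b : ℝ → ℝ}, Monotone a → Monotone b → MemLp (fun ω => a (X i ω)) 2 μ →
      MemLp (fun ω => b (X j ω)) 2 μ →
      0 ≤ cov[fun ω => a (X i ω), fun ω => b (X j ω); μ] := by
    intro a b ha hb haL hbL
    refine hX.covariance_nonneg (f := fun z => a (z i)) (g := fun z => b (z j)) (s := {i, j})
      (fun v w h => ha (h i)) (fun v w h => hb (h j)) (ha.measurable.comp (measurable_pi_apply i))
      (hb.measurable.comp (measurable_pi_apply j)) ?_ ?_ haL hbL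
    · intro v w h; simp [h i (by simp)]
    · intro v w h; simp [h j (by simp)]
  have h1 := key hf hgG hfL (hGL.sub hgL)
  have h2 := key hfF hG (hFL.sub hfL) hGL
  simp only [Pi.sub_apply] at h1 h2
  rw [covariance_fun_sub_right hfL hGL hgL] at h1
  rw [covariance_fun_sub_left hFL hfL hGL] at h2
  linarith

end Association

/-! ### The Newman–Wright maximal inequality -/

/-- The maximum of `0` and the partial sums `z m + ⋯ + z (m + j - 1)`, `j ≤ n`. The recursion
peels off the first summand, as the proof of the maximal inequality does. -/
noncomputable def maxPartialSum (z : ℕ → ℝ) : ℕ → ℕ → ℝ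
  | _, 0 => 0
  | m, n + 1 => max 0 (z m + maxPartialSum z (m + 1) n)

section MaxPartialSum

lemma maxPartialSum_nonneg (z : ℕ → ℝ) (m n : ℕ) : 0 ≤ maxPartialSum z m n := by
  cases n <;> simp [maxPartialSum]

lemma sum_le_maxPartialSum (z : ℕ → ℝ) (n : ℕ) :
    ∀ m, ∀ j ≤ n, ∑ i ∈ Finset.range j, z (m + i) ≤ maxPartialSum z m n := by
  induction n with
  | zero => intro m j hj; obtain rfl : j = 0 := by omega
            simp [maxPartialSum]
  | succ n ih =>
    intro m j hj
    cases j with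
    | zero => simpa using maxPartialSum_nonneg z m (n + 1)
    | succ j =>
      rw [Finset.sum_range_succ', maxPartialSum]
      have := ih (m + 1) j (by omega)
      have e : ∀ i, m + 1 + i = m + (i + 1) := fun i => by omega
      simp only [e] at this
      refine le_trans ?_ (le_max_right _ _)
      simp only [add_zero]
      linarith

lemma maxPartialSum_le_succ (z : ℕ → ℝ) (m n : ℕ) :
    maxPartialSum z m n ≤ maxPartialSum z m (n + 1) := by
  induction n generalizing m with
  | zero => exact maxPartialSum_nonneg z m 1
  | succ n ih => exact max_le_max le_rfl (add_le_add le_rfl (ih (m + 1)))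

lemma monotone_sum_sub_maxPartialSum (m n : ℕ) :
    Monotone fun z : ℕ → ℝ => ∑ i ∈ Finset.range n, z (m + i) - maxPartialSum z m n := by
  induction n generalizing m with
  | zero => intro v w h; simp [maxPartialSum]
  | succ n ih =>
    have e : (fun z : ℕ → ℝ => ∑ i ∈ Finset.range (n + 1), z (m + i) - maxPartialSum z m (n + 1))
        = fun z => min (∑ i ∈ Finset.range (n + 1), z (m + i))
          (∑ i ∈ Finset.range n, z (m + 1 + i) - maxPartialSum z (m + 1) n) := by
      funext z
      have e' : ∀ i, m + 1 + i = m + (i + 1) := fun i => by omega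
      rw [maxPartialSum, ← min_sub_sub_left, sub_zero, Finset.sum_range_succ']
      simp only [e', add_zero]
      congr 1
      ring
    rw [e]
    intro v w h
    exact min_le_min (Finset.sum_le_sum fun i _ => h _) (ih (m + 1) h)

lemma measurable_maxPartialSum (m n : ℕ) :
    Measurable fun z : ℕ → ℝ => maxPartialSum z m n := by
  induction n generalizing m with
  | zero => simp [maxPartialSum]
  | succ n ih => exact measurable_const.max ((measurable_pi_apply m).add (ih (m + 1)))

lemma dependsOn_maxPartialSum (m n : ℕ) :
    DependsOn (fun z : ℕ → ℝ => maxPartialSum z m n) (Finset.range (m + n) : Set ℕ) := by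
  induction n generalizing m with
  | zero => intro v w h; simp [maxPartialSum]
  | succ n ih =>
    intro v w h
    have h1 := ih (m + 1) (x := v) (y := w) (fun i hi => h i (by simp at hi ⊢; omega))
    simp only [maxPartialSum] at h1 ⊢
    rw [h1, h m (by simp)]

lemma memLp_maxPartialSum {Ω : Type*} [MeasurableSpace Ω] {μ : Measure Ω} {Z : ℕ → Ω → ℝ}
    (hL : ∀ i, MemLp (Z i) 2 μ) (m n : ℕ) :
    MemLp (fun ω => maxPartialSum (fun i => Z i ω) m n) 2 μ := by
  induction n generalizing m with
  | zero => simp [maxPartialSum]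
  | succ n ih =>
    have h := ((hL m).add (ih (m + 1))).pos_part
    simpa only [maxPartialSum, Pi.add_apply, max_comm] using h

/-- **Newman–Wright maximal inequality.** Write `M = max 0 (Z + L)` with `Z` the first summand, `L`
the maximum belonging to the remaining sum `T`. Since `T - L` is nondecreasing in the variables,
`Cov (Z, L) ≤ Cov (Z, T)`, and the second moments add up to at most `Var (Z + T)`. -/
theorem integral_maxPartialSum_sq_le {Ω : Type*} [MeasurableSpace Ω] {μ : Measure Ω}
    [IsProbabilityMeasure μ] {Z : ℕ → Ω → ℝ} (hZ : IsAssociatedSeq Z μ)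
    (hL : ∀ i, MemLp (Z i) 2 μ) (h0 : ∀ i, ∫ ω, Z i ω ∂μ = 0) (m n : ℕ) :
    ∫ ω, maxPartialSum (fun i => Z i ω) m n ^ 2 ∂μ
      ≤ Var[fun ω => ∑ i ∈ Finset.range n, Z (m + i) ω; μ] := by
  induction n generalizing m with
  | zero => simp [maxPartialSum, variance_nonneg]
  | succ n ih =>
    set L : Ω → ℝ := fun ω => maxPartialSum (fun i => Z i ω) (m + 1) n with hLdef
    set T : Ω → ℝ := fun ω => ∑ i ∈ Finset.range n, Z (m + 1 + i) ω with hTdef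
    have hLL : MemLp L 2 μ := memLp_maxPartialSum hL (m + 1) n
    have hTL : MemLp T 2 μ := memLp_finsetSum _ fun i _ => hL _
    have eS : (fun ω => ∑ i ∈ Finset.range (n + 1), Z (m + i) ω) = Z m + T := by
      funext ω
      have e' : ∀ i, m + 1 + i = m + (i + 1) := fun i => by omega
      simp only [hTdef, Pi.add_apply, e']
      rw [Finset.sum_range_succ', add_zero, add_comm]
    have hcov : 0 ≤ cov[Z m, T - L; μ] := by
      have h := hZ.covariance_nonneg (f := fun z => z m)
        (g := fun z => ∑ i ∈ Finset.range n, z (m + 1 + i) - maxPartialSum z (m + 1) n)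
        (s := Finset.range (m + 1 + n)) (fun v w h => h m)
        (monotone_sum_sub_maxPartialSum (m + 1) n) (measurable_pi_apply m)
        (by have := measurable_maxPartialSum (m + 1) n; fun_prop) ?_ ?_ (hL m) (hTL.sub hLL)
      · exact h
      · intro v w h
        exact h m (by simp; omega)
      · intro v w h
        have h1 := dependsOn_maxPartialSum (m + 1) n h
        simp only at h1 ⊢
        rw [h1, Finset.sum_congr rfl fun i hi => h (m + 1 + i) (by simp at hi ⊢; omega)]
    rw [covariance_sub_right (hL m) hTL hLL] at hcov
    have hZL : cov[Z m, L; μ] = ∫ ω, Z m ω * L ω ∂μ := by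
      rw [covariance_eq_sub (hL m) hLL, h0 m]; simp
    have hZv : Var[Z m; μ] = ∫ ω, Z m ω ^ 2 ∂μ := by
      rw [variance_eq_sub (hL m), h0 m]; simp
    have i1 : Integrable (fun ω => Z m ω ^ 2) μ := (hL m).integrable_sq
    have i2 : Integrable (fun ω => Z m ω * L ω) μ := (hL m).integrable_mul hLL
    have i3 : Integrable (fun ω => L ω ^ 2) μ := hLL.integrable_sq
    have i12 : Integrable (fun ω => Z m ω ^ 2 + 2 * (Z m ω * L ω)) μ := i1.add (i2.const_mul 2)
    have ihm := ih (m + 1)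
    rw [eS, variance_add (hL m) hTL]
    calc ∫ ω, maxPartialSum (fun i => Z i ω) m (n + 1) ^ 2 ∂μ
        ≤ ∫ ω, (Z m ω ^ 2 + 2 * (Z m ω * L ω) + L ω ^ 2) ∂μ := by
          refine integral_mono (memLp_maxPartialSum hL m (n + 1)).integrable_sq (i12.add i3) ?_
          intro ω
          simp only [maxPartialSum]
          change max 0 (Z m ω + L ω) ^ 2 ≤ _
          rcases max_cases 0 (Z m ω + L ω) with h | h <;> rw [h.1] <;>
            nlinarith [sq_nonneg (Z m ω + L ω)]
      _ = Var[Z m; μ] + 2 * cov[Z m, L; μ] + ∫ ω, L ω ^ 2 ∂μ := by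
          rw [integral_add i12 i3, integral_add i1 (i2.const_mul 2), integral_const_mul, hZv, hZL]
      _ ≤ _ := by linarith

end MaxPartialSum

/-! ### Almost sure convergence of series of associated variables -/

section AlmostSureConvergence

variable {Ω : Type*} [MeasurableSpace Ω] {μ : Measure Ω} [IsProbabilityMeasure μ] {Z : ℕ → Ω → ℝ}

lemma exists_variance_block_le (hL : ∀ i, MemLp (Z i) 2 μ)
    (hsum : Summable fun q : ℕ × ℕ => cov[Z q.1, Z q.2; μ]) {ε : ℝ} (hε : 0 < ε) :
    ∃ N, ∀ m ≥ N, ∀ n, Var[fun ω => ∑ i ∈ Finset.range n, Z (m + i) ω; μ] ≤ ε := by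
  obtain ⟨s, hs⟩ := summable_iff_vanishing.1 hsum _ (Metric.ball_mem_nhds 0 hε)
  obtain ⟨N, hN⟩ := (s.image Prod.fst).exists_nat_subset_range
  refine ⟨N, fun m hm n => ?_⟩
  have hdisj : Disjoint (Finset.Ico m (m + n) ×ˢ Finset.Ico m (m + n)) s := by
    rw [Finset.disjoint_left]
    intro q hq hqs
    have h1 := hN (Finset.mem_image_of_mem _ hqs)
    simp only [Finset.mem_product, Finset.mem_Ico, Finset.mem_range] at hq h1
    omega
  have h := hs _ hdisj
  rw [Metric.mem_ball, dist_zero_right, Finset.sum_product] at h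
  rw [variance_fun_sum' fun i _ => hL _]
  refine le_trans (le_of_eq ?_) ((le_abs_self _).trans h.le)
  simp only [Finset.sum_Ico_eq_sum_range, Nat.add_sub_cancel_left]

/-- Associated centred variables with summable covariance matrix have almost surely convergent
sums: by the maximal inequality and Fatou's lemma, the oscillation of the partial sums beyond `m`
has lower limit `0`. -/
theorem ae_exists_tendsto_sum_of_summable_covariance (hZ : IsAssociatedSeq Z μ)
    (hL : ∀ i, MemLp (Z i) 2 μ) (h0 : ∀ i, ∫ ω, Z i ω ∂μ = 0)
    (hsum : Summable fun q : ℕ × ℕ => cov[Z q.1, Z q.2; μ]) :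
    ∀ᵐ ω ∂μ, ∃ l, Tendsto (fun n => ∑ i ∈ Finset.range n, Z i ω) atTop (𝓝 l) := by
  let W : ℕ → Ω → ℝ := fun i ω => -Z i ω
  have hWL : ∀ i, MemLp (W i) 2 μ := fun i => (hL i).neg
  let U : ℕ → ℕ → Ω → ℝ := fun m n ω =>
    maxPartialSum (fun i => Z i ω) m n ^ 2 + maxPartialSum (fun i => W i ω) m n ^ 2
  have hUint : ∀ m n, Integrable (U m n) μ := fun m n =>
    (memLp_maxPartialSum hL m n).integrable_sq.add (memLp_maxPartialSum hWL m n).integrable_sq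
  have hU0 : ∀ m n ω, 0 ≤ U m n ω := fun m n ω => by positivity
  have hUle : ∀ m n,
      ∫ ω, U m n ω ∂μ ≤ 2 * Var[fun ω => ∑ i ∈ Finset.range n, Z (m + i) ω; μ] := by
    intro m n
    have h1 := integral_maxPartialSum_sq_le hZ hL h0 m n
    have h2 := integral_maxPartialSum_sq_le hZ.neg hWL
      (fun i => by simp [integral_neg, h0 i]) m n
    have e : (fun ω => ∑ i ∈ Finset.range n, W (m + i) ω)
        = fun ω => -∑ i ∈ Finset.range n, Z (m + i) ω := by
      funext ω; simp [W]
    rw [show (fun ω => ∑ i ∈ Finset.range n, -Z (m + i) ω)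
        = fun ω => -∑ i ∈ Finset.range n, Z (m + i) ω from e, variance_fun_neg] at h2
    rw [integral_add (memLp_maxPartialSum hL m n).integrable_sq
      (memLp_maxPartialSum hWL m n).integrable_sq]
    linarith
  let F : ℕ → Ω → ENNReal := fun m ω => ⨆ n, ENNReal.ofReal (U m n ω)
  have hFm : ∀ m, AEMeasurable (F m) μ := fun m =>
    AEMeasurable.iSup fun n => (hUint m n).aemeasurable.ennreal_ofReal
  have hFlim : Tendsto (fun m => ∫⁻ ω, F m ω ∂μ) atTop (𝓝 0) := by
    rw [ENNReal.tendsto_atTop_zero]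
    intro ε hε
    obtain ⟨δ, hδ, hδε⟩ : ∃ δ : ℝ, 0 < δ ∧ ENNReal.ofReal (2 * δ) ≤ ε := by
      rcases eq_or_ne ε ⊤ with rfl | hε'
      · exact ⟨1, one_pos, le_top⟩
      · refine ⟨ε.toReal / 2, half_pos (ENNReal.toReal_pos hε.ne' hε'), ?_⟩
        rw [mul_div_cancel₀ _ two_ne_zero, ENNReal.ofReal_toReal hε']
    obtain ⟨N, hN⟩ := exists_variance_block_le hL hsum hδ
    refine ⟨N, fun m hm => ?_⟩
    rw [lintegral_iSup' (fun n => (hUint m n).aemeasurable.ennreal_ofReal)]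
    · refine iSup_le fun n => ?_
      rw [← ofReal_integral_eq_lintegral_ofReal (hUint m n) (ae_of_all _ (hU0 m n))]
      refine le_trans (ENNReal.ofReal_le_ofReal ?_) hδε
      linarith [hUle m n, hN m hm n]
    · refine ae_of_all _ fun ω => monotone_nat_of_le_succ fun n => ENNReal.ofReal_le_ofReal ?_
      exact add_le_add
        (pow_le_pow_left₀ (maxPartialSum_nonneg _ _ _) (maxPartialSum_le_succ _ _ _) 2)
        (pow_le_pow_left₀ (maxPartialSum_nonneg _ _ _) (maxPartialSum_le_succ _ _ _) 2)
  have hlim : ∫⁻ ω, liminf (fun m => F m ω) atTop ∂μ = 0 :=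
    le_antisymm ((lintegral_liminf_le' hFm).trans_eq hFlim.liminf_eq) zero_le
  have hlm : AEMeasurable (fun ω => liminf (fun m => F m ω) atTop) μ := by
    simp_rw [liminf_eq_iSup_iInf_of_nat']
    exact AEMeasurable.iSup fun n => AEMeasurable.iInf fun i => hFm (i + n)
  rw [lintegral_eq_zero_iff' hlm] at hlim
  filter_upwards [hlim] with ω hω
  have hω' : liminf (fun m => F m ω) atTop = 0 := hω
  refine cauchySeq_tendsto_of_complete (Metric.cauchySeq_iff'.2 fun ε hε => ?_)
  have hfr : ∃ᶠ m in atTop, F m ω < ENNReal.ofReal (ε ^ 2) :=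
    frequently_lt_of_liminf_lt (by isBoundedDefault)
      (by rw [hω']; exact ENNReal.ofReal_pos.2 (by positivity))
  obtain ⟨m, hm⟩ := hfr.exists
  refine ⟨m, fun n hn => ?_⟩
  obtain ⟨j, rfl⟩ := Nat.exists_eq_add_of_le hn
  have hU : U m j ω < ε ^ 2 := by
    have := (le_iSup (fun n => ENNReal.ofReal (U m n ω)) j).trans_lt hm
    exact (ENNReal.ofReal_lt_ofReal_iff (by positivity)).1 this
  rw [Real.dist_eq, Finset.sum_range_add, add_sub_cancel_left]
  have h1 := sum_le_maxPartialSum (fun i => Z i ω) j m j le_rfl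
  have h2 := sum_le_maxPartialSum (fun i => W i ω) j m j le_rfl
  simp only [W, Finset.sum_neg_distrib] at h2
  refine abs_lt_of_sq_lt_sq (lt_of_le_of_lt ?_ hU) hε.le
  rcases le_total 0 (∑ i ∈ Finset.range j, Z (m + i) ω) with h | h
  · have := pow_le_pow_left₀ h h1 2
    have := sq_nonneg (maxPartialSum (fun i => W i ω) m j)
    simp only [U]; linarith
  · have := pow_le_pow_left₀ (neg_nonneg.2 h) h2 2
    have := sq_nonneg (maxPartialSum (fun i => Z i ω) m j)
    simp only [U, W]; linarith

end AlmostSureConvergence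

/-! ### Truncation and Hoeffding's covariance formula -/

/-- The truncation of `x` to the interval `[-u, u]`. -/
noncomputable def clamp (u x : ℝ) : ℝ := max (-u) (min u x)

lemma monotone_clamp (u : ℝ) : Monotone (clamp u) := fun _ _ h =>
  max_le_max le_rfl (min_le_min le_rfl h)

lemma abs_clamp_le {u : ℝ} (hu : 0 ≤ u) (x : ℝ) : |clamp u x| ≤ u :=
  abs_le.2 ⟨le_max_left _ _, max_le (by linarith) (min_le_left _ _)⟩

lemma abs_clamp_le_abs {u : ℝ} (hu : 0 ≤ u) (x : ℝ) : |clamp u x| ≤ |x| := by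
  unfold clamp
  rcases max_cases (-u) (min u x) with h | h <;> rcases min_cases u x with h' | h' <;>
    rcases abs_cases x with h'' | h'' <;> rw [h.1] <;> rw [abs_le] <;> constructor <;> linarith

lemma clamp_of_abs_le {u x : ℝ} (h : |x| ≤ u) : clamp u x = x := by
  rw [abs_le] at h
  rw [clamp, min_eq_right h.2, max_eq_right h.1]

lemma abs_sub_clamp_le {u : ℝ} (hu : 0 ≤ u) (x : ℝ) : |x - clamp u x| ≤ max (|x| - u) 0 := by
  unfold clamp
  rcases max_cases (-u) (min u x) with h | h <;> rcases min_cases u x with h' | h' <;>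
    rcases abs_cases x with h'' | h'' <;> rcases max_cases (|x| - u) 0 with h3 | h3 <;>
    rw [h.1] <;> rw [abs_le] <;> constructor <;> linarith

lemma memLp_clamp {Ω : Type*} [MeasurableSpace Ω] {μ : Measure Ω} [IsFiniteMeasure μ] {X : Ω → ℝ}
    (hX : AEMeasurable X μ) {u : ℝ} (hu : 0 ≤ u) (r : ENNReal) :
    MemLp (fun ω => clamp u (X ω)) r μ :=
  MemLp.of_bound ((monotone_clamp u).measurable.comp_aemeasurable hX).aestronglyMeasurable u
    (ae_of_all _ fun ω => abs_clamp_le hu (X ω))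

lemma covariance_congr_ae {Ω : Type*} [MeasurableSpace Ω] {μ : Measure Ω} {X X' Y Y' : Ω → ℝ}
    (hX : X =ᵐ[μ] X') (hY : Y =ᵐ[μ] Y') : cov[X, Y; μ] = cov[X', Y'; μ] := by
  unfold covariance
  rw [integral_congr_ae hX, integral_congr_ae hY]
  refine integral_congr_ae ?_
  filter_upwards [hX, hY] with ω h1 h2
  rw [h1, h2]

lemma intervalIntegral_indicator_lt {v : ℝ} (hv : 0 ≤ v) (a : ℝ) :
    ∫ y in (-v)..v, (if y < a then 1 else 0 : ℝ) = clamp v a + v := by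
  have e : (fun y : ℝ => (if y < a then 1 else 0 : ℝ)) = (Set.Iio a).indicator 1 := by
    funext y; simp [Set.indicator]
  rw [e, intervalIntegral.integral_of_le (by linarith), integral_Ioc_eq_integral_Ioo,
    integral_indicator_one measurableSet_Iio, measureReal_restrict_apply measurableSet_Iio,
    Set.inter_comm, Set.Ioo_inter_Iio, Measure.real, Real.volume_Ioo, ENNReal.toReal_ofReal', clamp,
    max_comm (-v), ← max_add_add_right]
  simp

/-- Fubini's theorem for the weighted tail `y ↦ E [W; Y > y]`. -/
lemma intervalIntegral_integral_ite_lt {Ω : Type*} [MeasurableSpace Ω] {μ : Measure Ω}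
    [IsFiniteMeasure μ] {W Y : Ω → ℝ} (hW : Integrable W μ) (hY : Measurable Y) {v : ℝ}
    (hv : 0 ≤ v) :
    ∫ y in (-v)..v, ∫ ω, (if y < Y ω then 1 else 0) * W ω ∂μ
      = ∫ ω, (clamp v (Y ω) + v) * W ω ∂μ := by
  rw [intervalIntegral.integral_of_le (by linarith), integral_integral_swap]
  · refine integral_congr_ae (ae_of_all _ fun ω => ?_)
    simp only
    rw [integral_mul_const, ← intervalIntegral.integral_of_le (by linarith),
      intervalIntegral_indicator_lt hv]
  · have h1 : Integrable (fun q : ℝ × Ω => W q.2) ((volume.restrict (Set.Ioc (-v) v)).prod μ) :=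
      hW.comp_snd _
    refine h1.bdd_mul (c := 1) ?_ (ae_of_all _ fun q => ?_)
    · exact (Measurable.ite (measurableSet_lt measurable_fst (hY.comp measurable_snd))
        measurable_const measurable_const).aestronglyMeasurable
    · split_ifs <;> simp

/-- **Hoeffding's formula** for truncated variables. -/
theorem truncCov_eq_covariance {Ω : Type*} [MeasurableSpace Ω] {μ : Measure Ω}
    [IsProbabilityMeasure μ] {X Y : Ω → ℝ} (hX : AEMeasurable X μ) (hY : AEMeasurable Y μ) {u v : ℝ}
    (hu : 0 ≤ u) (hv : 0 ≤ v) :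
    truncCov X Y μ u v = cov[fun ω => clamp u (X ω), fun ω => clamp v (Y ω); μ] := by
  wlog hm : Measurable X ∧ Measurable Y generalizing X Y
  · have h := this hX.measurable_mk.aemeasurable hY.measurable_mk.aemeasurable
      ⟨hX.measurable_mk, hY.measurable_mk⟩
    have hXe := hX.ae_eq_mk
    have hYe := hY.ae_eq_mk
    have e1 : truncCov X Y μ u v = truncCov (hX.mk X) (hY.mk Y) μ u v := by
      unfold truncCov
      congr 1; funext y; congr 1; funext x
      unfold jointTailDiff
      congr 1
      · refine measureReal_congr ?_
        filter_upwards [hXe, hYe] with ω h1 h2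
        apply propext
        change (x < X ω ∧ y < Y ω) ↔ (x < hX.mk X ω ∧ y < hY.mk Y ω)
        rw [h1, h2]
      · congr 1 <;> refine measureReal_congr ?_
        · filter_upwards [hXe] with ω h1
          apply propext
          change x < X ω ↔ x < hX.mk X ω
          rw [h1]
        · filter_upwards [hYe] with ω h1
          apply propext
          change y < Y ω ↔ y < hY.mk Y ω
          rw [h1]
    rw [e1, h]
    refine covariance_congr_ae ?_ ?_
    · filter_upwards [hXe] with ω h1; rw [← h1]
    · filter_upwards [hYe] with ω h1; rw [← h1]
  obtain ⟨hXm, hYm⟩ := hm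
  have cX := memLp_clamp hX hu 2
  have cY := memLp_clamp hY hv 2
  have ind : ∀ {Z : Ω → ℝ} (_ : Measurable Z) (x : ℝ),
      Integrable (fun ω => (if x < Z ω then 1 else 0 : ℝ)) μ := fun hZ x =>
    Integrable.of_bound (Measurable.ite (measurableSet_lt measurable_const hZ)
      measurable_const measurable_const).aestronglyMeasurable 1
      (ae_of_all _ fun ω => by split_ifs <;> simp)
  have tail : ∀ {Z : Ω → ℝ} (_ : Measurable Z) (x : ℝ),
      μ.real {ω | x < Z ω} = ∫ ω, (if x < Z ω then 1 else 0 : ℝ) ∂μ := by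
    intro Z hZ x
    rw [← integral_indicator_one (measurableSet_lt measurable_const hZ)]
    simp [Set.indicator]
  have joint : ∀ x y, μ.real {ω | x < X ω ∧ y < Y ω}
      = ∫ ω, (if x < X ω then 1 else 0) * (if y < Y ω then 1 else 0 : ℝ) ∂μ := by
    intro x y
    have hs : MeasurableSet {ω | x < X ω ∧ y < Y ω} :=
      (measurableSet_lt measurable_const hXm).inter (measurableSet_lt measurable_const hYm)
    rw [← integral_indicator_one hs]
    refine integral_congr_ae (ae_of_all _ fun ω => ?_)
    by_cases h1 : x < X ω <;> by_cases h2 : y < Y ω <;> simp [Set.indicator, h1, h2]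
  -- Centring the second factor merges the joint tail and the product of the tails.
  have hdiff : ∀ x y, jointTailDiff X Y μ x y
      = ∫ ω, (if x < X ω then 1 else 0) *
        ((if y < Y ω then 1 else 0) - μ.real {ω | y < Y ω}) ∂μ := by
    intro x y
    simp_rw [mul_sub]
    rw [integral_sub _ ((ind hXm x).mul_const _), integral_mul_const, jointTailDiff, joint,
      tail hXm]
    exact (ind hYm y).bdd_mul (c := 1) (ind hXm x).aestronglyMeasurable
      (ae_of_all _ fun ω => by split_ifs <;> simp)
  have hinner : ∀ y, ∫ x in (-u)..u, jointTailDiff X Y μ x y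
      = ∫ ω, (if y < Y ω then 1 else 0) *
        ((clamp u (X ω) + u) - ∫ ω', (clamp u (X ω') + u) ∂μ) ∂μ := by
    intro y
    simp_rw [hdiff]
    have hW : Integrable (fun ω => (if y < Y ω then 1 else 0) - μ.real {ω | y < Y ω}) μ :=
      (ind hYm y).sub (integrable_const _)
    have hcX : Integrable (fun ω => clamp u (X ω) + u) μ :=
      (cX.integrable (by simp)).add (integrable_const _)
    rw [intervalIntegral_integral_ite_lt hW hXm hu]
    have i1 : Integrable (fun ω => (clamp u (X ω) + u) * (if y < Y ω then 1 else 0 : ℝ)) μ :=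
      hcX.mul_bdd (c := 1) (ind hYm y).aestronglyMeasurable
        (ae_of_all _ fun ω => by split_ifs <;> simp)
    have i2 : Integrable (fun ω => (if y < Y ω then 1 else 0 : ℝ) * (clamp u (X ω) + u)) μ := by
      simpa only [mul_comm] using i1
    simp_rw [mul_sub]
    rw [integral_sub i1 (hcX.mul_const _), integral_sub i2 ((ind hYm y).mul_const _),
      integral_mul_const, integral_mul_const, ← tail hYm, mul_comm (μ.real _)]
    simp_rw [mul_comm]
  unfold truncCov
  simp_rw [hinner]
  have hcX : Integrable (fun ω => clamp u (X ω)) μ := cX.integrable (by simp)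
  have hcY : Integrable (fun ω => clamp v (Y ω)) μ := cY.integrable (by simp)
  have hW : Integrable (fun ω => (clamp u (X ω) + u) - ∫ ω', (clamp u (X ω') + u) ∂μ) μ :=
    (hcX.add (integrable_const _)).sub (integrable_const _)
  rw [intervalIntegral_integral_ite_lt hW hYm hv, ← covariance_add_const_right hcY v,
    ← covariance_add_const_left hcX u]
  have e := covariance_eq_sub (cX.add (memLp_const u)) (cY.add (memLp_const v))
  have i3 := (cX.add (memLp_const u)).integrable_mul (cY.add (memLp_const v))
  simp only [Pi.add_def, Pi.mul_def] at e i3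
  rw [e]
  have i4 : Integrable (fun ω => clamp v (Y ω) + v) μ := hcY.add (integrable_const _)
  simp_rw [mul_sub]
  rw [integral_sub (by simpa only [mul_comm] using i3) (i4.mul_const _), integral_mul_const,
    mul_comm (∫ ω, clamp v (Y ω) + v ∂μ)]
  simp_rw [mul_comm]

/-! ### Deterministic sums -/

section Deterministic

/-- **Kronecker's lemma.** -/
theorem tendsto_sum_mul_div_of_tendsto_sum {c z : ℕ → ℝ} {l : ℝ} (hc : Monotone c)
    (hc' : Tendsto c atTop atTop)
    (hz : Tendsto (fun n => ∑ k ∈ Finset.range n, z k) atTop (𝓝 l)) :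
    Tendsto (fun n => (∑ k ∈ Finset.range n, c (k + 1) * z k) / c n) atTop (𝓝 0) := by
  set R : ℕ → ℝ := fun n => ∑ k ∈ Finset.range n, z k - l with hR
  have hR0 : Tendsto R atTop (𝓝 0) := by simpa [hR] using hz.sub_const l
  have abel : ∀ n, ∑ k ∈ Finset.range n, c (k + 1) * z k
      = c n * R n - c 0 * R 0 - ∑ k ∈ Finset.range n, (c (k + 1) - c k) * R k := by
    intro n
    induction n with
    | zero => simp
    | succ n ih =>
      have hz' : z n = R (n + 1) - R n := by simp [hR, Finset.sum_range_succ]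
      rw [Finset.sum_range_succ, ih, Finset.sum_range_succ, hz']
      ring
  have tel : ∀ n, ∑ k ∈ Finset.range n, (c (k + 1) - c k) = c n - c 0 := fun n =>
    Finset.sum_range_sub c n
  have hO : (fun k => (c (k + 1) - c k) * R k) =o[atTop] fun k => c (k + 1) - c k := by
    simpa using (Asymptotics.isBigO_refl (fun k => c (k + 1) - c k) atTop).mul_isLittleO
      ((Asymptotics.isLittleO_one_iff ℝ).2 hR0)
  have hsum := hO.sum_range (fun k => sub_nonneg.2 (hc k.le_succ))
    (by simp_rw [tel]; exact tendsto_atTop_add_const_right _ _ hc')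
  simp_rw [tel] at hsum
  have hO' : (fun n => c n - c 0) =O[atTop] c :=
    (Asymptotics.isBigO_refl c atTop).sub
      (Asymptotics.isLittleO_const_left.2 (Or.inr (by
        exact tendsto_norm_atTop_atTop.comp hc'))).isBigO
  have h1 := (hsum.trans_isBigO hO').tendsto_div_nhds_zero
  have h2 : Tendsto (fun n => c 0 * R 0 / c n) atTop (𝓝 0) := hc'.const_div_atTop _
  have h3 := (hR0.sub h2).sub h1
  simp only [sub_zero] at h3
  refine h3.congr' ?_
  filter_upwards [hc'.eventually_gt_atTop 0] with n hn
  rw [abel]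
  field_simp

/-- Comparison of `n ^ (-r)` with a telescoping difference. -/
lemma rpow_neg_le_sub_rpow {r x : ℝ} (hr : 1 < r) (hx : 0 < x) :
    (r - 1) * (x + 1) ^ (-r) ≤ x ^ (1 - r) - (x + 1) ^ (1 - r) := by
  have hx1 : 0 < x + 1 := by linarith
  have hq : 0 < x / (x + 1) := div_pos hx hx1
  have e1 : x ^ (1 - r) = (x + 1) ^ (1 - r) * (x / (x + 1)) ^ (1 - r) := by
    rw [← Real.mul_rpow hx1.le hq.le, mul_div_cancel₀ _ hx1.ne']
  have e2 : (x + 1) ^ (-r) = (x + 1) ^ (1 - r) * (1 / (x + 1)) := by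
    rw [show (-r : ℝ) = (1 - r) - 1 by ring, Real.rpow_sub_one hx1.ne']; ring
  have h1 : 1 + (r - 1) / (x + 1) ≤ (x / (x + 1)) ^ (1 - r) := by
    rw [Real.rpow_def_of_pos hq]
    have ha := Real.add_one_le_exp (Real.log (x / (x + 1)) * (1 - r))
    have hb := Real.log_le_sub_one_of_pos hq
    have hd : x / (x + 1) - 1 = -(1 / (x + 1)) := by field_simp; ring
    have hb' := mul_le_mul_of_nonpos_right hb (by linarith : 1 - r ≤ 0)
    rw [hd] at hb'
    have hd' : -(1 / (x + 1)) * (1 - r) = (r - 1) / (x + 1) := by ring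
    linarith
  have h0 : 0 < (x + 1) ^ (1 - r) := Real.rpow_pos_of_pos hx1 _
  rw [e1, e2]
  have := mul_le_mul_of_nonneg_left h1 h0.le
  have e : (r - 1) * ((x + 1) ^ (1 - r) * (1 / (x + 1)))
      = (x + 1) ^ (1 - r) * ((r - 1) / (x + 1)) := by ring
  rw [e]
  linarith

lemma sum_min_div_rpow_le {r t : ℝ} (hr : 1 < r) (ht : 0 ≤ t) (N : ℕ) :
    ∑ k ∈ Finset.range N, min 1 (t / ((k + 1 : ℕ) : ℝ)) ^ r ≤ (2 + 1 / (r - 1)) * max t 1 := by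
  have hr0 : 0 < r - 1 := by linarith
  set T : ℝ := max t 1 with hT
  have hT1 : 1 ≤ T := le_max_right _ _
  have htT : t ≤ T := le_max_left _ _
  have hT0 : 0 < T := by linarith
  set n₀ : ℕ := ⌈T⌉₊ with hn₀
  have hn1 : T ≤ n₀ := Nat.le_ceil T
  have hn2 : (n₀ : ℝ) ≤ 2 * T := by have := Nat.ceil_lt_add_one hT0.le; linarith
  have hn0 : (0 : ℝ) < n₀ := by linarith
  have hmin : ∀ k : ℕ, 0 ≤ min 1 (t / ((k + 1 : ℕ) : ℝ)) := fun k =>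
    le_min zero_le_one (by positivity)
  have hsmall : ∀ n : ℕ, ∑ k ∈ Finset.range n, min 1 (t / ((k + 1 : ℕ) : ℝ)) ^ r ≤ n := by
    intro n
    refine (Finset.sum_le_sum fun k _ =>
      Real.rpow_le_one (hmin k) (min_le_left _ _) (by linarith)).trans ?_
    simp
  have hlarge : ∀ n ≥ n₀, ∑ k ∈ Finset.range n, min 1 (t / ((k + 1 : ℕ) : ℝ)) ^ r
      ≤ n₀ + T ^ r * ((n₀ : ℝ) ^ (1 - r) - (n : ℝ) ^ (1 - r)) / (r - 1) := by
    intro n hn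
    induction n, hn using Nat.le_induction with
    | base => simpa using hsmall n₀
    | succ n hn ih =>
      have hnpos : (0 : ℝ) < n := hn0.trans_le (by exact_mod_cast hn)
      have h1 := rpow_neg_le_sub_rpow hr hnpos
      have h2 : min 1 (t / ((n + 1 : ℕ) : ℝ)) ^ r ≤ T ^ r * ((n : ℝ) + 1) ^ (-r) := by
        rw [Real.rpow_neg (by positivity), ← div_eq_mul_inv,
          ← Real.div_rpow hT0.le (by positivity)]
        refine Real.rpow_le_rpow (hmin n) ((min_le_right _ _).trans ?_) (by linarith)
        push_cast
        gcongr
      have h3 : T ^ r * ((n : ℝ) + 1) ^ (-r)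
          ≤ T ^ r * ((n : ℝ) ^ (1 - r) - ((n : ℝ) + 1) ^ (1 - r)) / (r - 1) := by
        rw [le_div_iff₀ hr0, mul_assoc]
        refine mul_le_mul_of_nonneg_left ?_ (by positivity)
        linarith
      rw [Finset.sum_range_succ]
      push_cast at h2 ⊢
      have e : T ^ r * ((n₀ : ℝ) ^ (1 - r) - ((n : ℝ) + 1) ^ (1 - r)) / (r - 1)
          = T ^ r * ((n₀ : ℝ) ^ (1 - r) - (n : ℝ) ^ (1 - r)) / (r - 1)
            + T ^ r * ((n : ℝ) ^ (1 - r) - ((n : ℝ) + 1) ^ (1 - r)) / (r - 1) := by ring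
      push_cast at ih
      linarith
  have htail : T ^ r * (n₀ : ℝ) ^ (1 - r) ≤ T := by
    calc T ^ r * (n₀ : ℝ) ^ (1 - r) ≤ T ^ r * T ^ (1 - r) := by
          refine mul_le_mul_of_nonneg_left ?_ (by positivity)
          exact Real.rpow_le_rpow_of_nonpos hT0 hn1 (by linarith)
      _ = T := by rw [← Real.rpow_add hT0]; simp
  have hquot : 0 ≤ T / (r - 1) := by positivity
  have e0 : (2 + 1 / (r - 1)) * T = 2 * T + T / (r - 1) := by ring
  rw [e0]
  rcases le_total N n₀ with h | h
  · have := hsmall N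
    have : (N : ℝ) ≤ n₀ := by exact_mod_cast h
    linarith
  · refine (hlarge N h).trans (add_le_add hn2 ?_)
    refine div_le_div_of_nonneg_right ?_ hr0.le
    rw [mul_sub]
    have : 0 ≤ T ^ r * (N : ℝ) ^ (1 - r) := by positivity
    linarith

end Deterministic

/-! ### The normalizing sequence -/

/-- The truncation level `(n + 1) ^ (1 / p)` of the variable with index `n ≥ 0`. -/
noncomputable def rootSeq (p : ℝ) (n : ℕ) : ℝ := ((n + 1 : ℕ) : ℝ) ^ (1 / p)

section RootSeq

variable {p : ℝ}

lemma rootSeq_pos (p : ℝ) (n : ℕ) : 0 < rootSeq p n := by unfold rootSeq; positivity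

lemma tendsto_natCast_rpow_one_div_atTop (hp : 1 ≤ p) :
    Tendsto (fun n : ℕ => (n : ℝ) ^ (1 / p)) atTop atTop :=
  (tendsto_rpow_atTop (by positivity)).comp tendsto_natCast_atTop_atTop

lemma tendsto_rootSeq_atTop (hp : 1 ≤ p) : Tendsto (rootSeq p) atTop atTop :=
  (tendsto_natCast_rpow_one_div_atTop hp).comp (tendsto_add_atTop_nat 1)

lemma rootSeq_rpow (hp : 1 ≤ p) (n : ℕ) : rootSeq p n ^ p = (n + 1 : ℕ) := by
  rw [rootSeq, ← Real.rpow_mul (by positivity), one_div_mul_cancel (by positivity), Real.rpow_one]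

lemma rootSeq_le_iff (hp : 1 ≤ p) (n : ℕ) {x : ℝ} (hx : 0 ≤ x) :
    rootSeq p n ≤ x ↔ ((n + 1 : ℕ) : ℝ) ≤ x ^ p := by
  rw [← rootSeq_rpow hp n, Real.rpow_le_rpow_iff (rootSeq_pos p n).le hx (by positivity)]

lemma clamp_div_rootSeq_sq_le (hp : 1 ≤ p) (n : ℕ) (x : ℝ) :
    (clamp (rootSeq p n) x / rootSeq p n) ^ 2
      ≤ min 1 (|x| ^ p / ((n + 1 : ℕ) : ℝ)) ^ (2 / p) := by
  have hb := rootSeq_pos p n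
  have hp0 : 0 < p := by linarith
  have hn : (0 : ℝ) < ((n + 1 : ℕ) : ℝ) := by positivity
  rw [div_pow, ← sq_abs (clamp _ _)]
  rcases le_total 1 (|x| ^ p / ((n + 1 : ℕ) : ℝ)) with h | h
  · rw [min_eq_left h, Real.one_rpow, div_le_one (by positivity)]
    exact pow_le_pow_left₀ (abs_nonneg _) (abs_clamp_le hb.le x) 2
  · rw [min_eq_right h, ← rootSeq_rpow hp n, ← Real.div_rpow (abs_nonneg x) hb.le,
      ← Real.rpow_mul (by positivity), mul_div_cancel₀ _ hp0.ne', ← div_pow,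
      show (2 : ℝ) = ((2 : ℕ) : ℝ) by norm_num, Real.rpow_natCast]
    refine pow_le_pow_left₀ (by positivity) ?_ 2
    exact div_le_div_of_nonneg_right (abs_clamp_le_abs hb.le x) hb.le

/-- Only indices `k < ⌊x ^ p⌋` contribute to the excess of `x` over the truncation levels. -/
lemma sum_max_sub_rootSeq_le (hp : 1 ≤ p) {x : ℝ} (hx : 0 ≤ x) (n : ℕ) :
    ∑ k ∈ Finset.range n, max (x - rootSeq p k) 0 ≤ (min n ⌊x ^ p⌋₊ : ℕ) * x := by
  calc ∑ k ∈ Finset.range n, max (x - rootSeq p k) 0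
      ≤ ∑ k ∈ Finset.range n, if k < ⌊x ^ p⌋₊ then x else 0 := by
        refine Finset.sum_le_sum fun k _ => ?_
        have hb := rootSeq_pos p k
        split_ifs with h
        · exact max_le (by linarith) hx
        · refine max_le (sub_nonpos.2 ?_) le_rfl
          by_contra! hlt
          have := (rootSeq_le_iff hp k hx).1 hlt.le
          exact h (Nat.succ_le_iff.1 (Nat.le_floor this))
    _ = _ := by
        rw [← Finset.sum_filter, Finset.sum_const, nsmul_eq_mul]
        congr 2
        rw [show Finset.filter (fun k => k < ⌊x ^ p⌋₊) (Finset.range n)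
          = Finset.range (min n ⌊x ^ p⌋₊) by ext k; simp, Finset.card_range]

lemma sum_max_sub_rootSeq_div_le (hp : 1 ≤ p) {x : ℝ} (hx : 0 ≤ x) (n : ℕ) :
    (∑ k ∈ Finset.range n, max (x - rootSeq p k) 0) / (n : ℝ) ^ (1 / p) ≤ x ^ p := by
  have hp0 : 0 < p := by linarith
  have hs0 : 0 < 1 / p := by positivity
  have hs1 : 0 ≤ 1 - 1 / p := by
    have : 1 / p ≤ 1 := by rw [div_le_one hp0]; exact hp
    linarith
  refine div_le_of_le_mul₀ (by positivity) (by positivity)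
    ((sum_max_sub_rootSeq_le hp hx n).trans ?_)
  set N : ℕ := min n ⌊x ^ p⌋₊ with hN
  have ht : 0 ≤ x ^ p := by positivity
  have h1 : (N : ℝ) ≤ n := by exact_mod_cast min_le_left _ _
  have h2 : (N : ℝ) ≤ x ^ p := le_trans (by exact_mod_cast min_le_right _ _) (Nat.floor_le ht)
  rcases Nat.eq_zero_or_pos N with h0 | h0
  · rw [h0]; simp; positivity
  have hNpos : (0 : ℝ) < N := by exact_mod_cast h0
  have htpos : 0 < x ^ p := hNpos.trans_le h2
  have ex : x = (x ^ p) ^ (1 / p) := by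
    rw [← Real.rpow_mul hx, mul_one_div_cancel hp0.ne', Real.rpow_one]
  calc (N : ℝ) * x = (N : ℝ) ^ (1 - 1 / p) * (N : ℝ) ^ (1 / p) * (x ^ p) ^ (1 / p) := by
        rw [← ex, ← Real.rpow_add hNpos]; simp
    _ ≤ (x ^ p) ^ (1 - 1 / p) * (n : ℝ) ^ (1 / p) * (x ^ p) ^ (1 / p) := by gcongr
    _ = (x ^ p) ^ (1 - 1 / p) * (x ^ p) ^ (1 / p) * (n : ℝ) ^ (1 / p) := by ring
    _ = x ^ p * (n : ℝ) ^ (1 / p) := by rw [← Real.rpow_add htpos]; simp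

lemma tendsto_sum_max_sub_rootSeq_div (hp : 1 ≤ p) {x : ℝ} (hx : 0 ≤ x) :
    Tendsto (fun n : ℕ => (∑ k ∈ Finset.range n, max (x - rootSeq p k) 0) / (n : ℝ) ^ (1 / p))
      atTop (𝓝 0) := by
  refine squeeze_zero (fun n => by positivity) (fun n => ?_)
    ((tendsto_natCast_rpow_one_div_atTop hp).const_div_atTop (⌊x ^ p⌋₊ * x))
  refine div_le_div_of_nonneg_right ((sum_max_sub_rootSeq_le hp hx n).trans ?_) (by positivity)
  gcongr
  exact min_le_right _ _

end RootSeq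

/-! ### Tail sums and moments -/

section Tails

variable {Ω : Type*} [MeasurableSpace Ω] {μ : Measure Ω}

lemma tsum_measure_natCast_le_eq_lintegral_floor {T : Ω → ℝ} (hT : AEMeasurable T μ)
    (hT0 : ∀ ω, 0 ≤ T ω) :
    ∑' k : ℕ, μ {ω | ((k + 1 : ℕ) : ℝ) ≤ T ω} = ∫⁻ ω, (⌊T ω⌋₊ : ENNReal) ∂μ := by
  have hm : ∀ k : ℕ, NullMeasurableSet {ω | ((k + 1 : ℕ) : ℝ) ≤ T ω} μ := fun k =>
    nullMeasurableSet_le aemeasurable_const hT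
  simp_rw [← fun k => lintegral_indicator_one₀ (hm k), Pi.one_def]
  rw [← lintegral_tsum fun k => (aemeasurable_const (b := (1 : ENNReal))).indicator₀ (hm k)]
  refine lintegral_congr fun ω => ?_
  rw [tsum_eq_sum (s := Finset.range ⌊T ω⌋₊)]
  · rw [Finset.sum_congr rfl (g := fun _ => (1 : ENNReal))]
    · simp
    · intro k hk
      have : ((k + 1 : ℕ) : ℝ) ≤ T ω :=
        (Nat.le_floor_iff (hT0 ω)).1 (Nat.succ_le_iff.2 (Finset.mem_range.1 hk))
      exact Set.indicator_of_mem (s := {ω | ((k + 1 : ℕ) : ℝ) ≤ T ω}) this _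
  · intro k hk
    refine Set.indicator_of_notMem (fun h => hk ?_) _
    exact Finset.mem_range.2 (Nat.succ_le_iff.1 (Nat.le_floor h))

/-- A nonnegative random variable is integrable iff its tail probabilities are summable. -/
lemma integrable_iff_tsum_measure_natCast_le_ne_top [IsFiniteMeasure μ] {T : Ω → ℝ}
    (hT : AEMeasurable T μ) (hT0 : ∀ ω, 0 ≤ T ω) :
    Integrable T μ ↔ ∑' k : ℕ, μ {ω | ((k + 1 : ℕ) : ℝ) ≤ T ω} ≠ ⊤ := by
  rw [tsum_measure_natCast_le_eq_lintegral_floor hT hT0, ← lt_top_iff_ne_top]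
  have hfl : ∀ ω, (⌊T ω⌋₊ : ENNReal) = ENNReal.ofReal (⌊T ω⌋₊ : ℝ) := fun ω => by simp
  have hint : Integrable T μ ↔ ∫⁻ ω, ENNReal.ofReal (T ω) ∂μ < ⊤ := by
    rw [← hasFiniteIntegral_iff_ofReal (ae_of_all _ hT0)]
    exact ⟨fun h => h.2, fun h => ⟨hT.aestronglyMeasurable, h⟩⟩
  rw [hint]
  constructor
  · refine fun h => lt_of_le_of_lt (lintegral_mono fun ω => ?_) h
    rw [hfl]
    exact ENNReal.ofReal_le_ofReal (Nat.floor_le (hT0 ω))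
  · intro h
    have h1 : ∫⁻ ω, ((⌊T ω⌋₊ : ENNReal) + 1) ∂μ < ⊤ := by
      rw [lintegral_add_right _ measurable_const]
      exact ENNReal.add_lt_top.2 ⟨h, by simp⟩
    refine lt_of_le_of_lt (lintegral_mono fun ω => ?_) h1
    rw [hfl, ← ENNReal.ofReal_one, ← ENNReal.ofReal_add (by positivity) zero_le_one]
    exact ENNReal.ofReal_le_ofReal (Nat.lt_floor_add_one _).le

end Tails

/-! ### A converse Borel–Cantelli lemma -/

section BorelCantelli

variable {Ω : Type*} [MeasurableSpace Ω] {μ : Measure Ω} [IsProbabilityMeasure μ]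

/-- If the variances of the partial sums `T n` of nonnegative variables are at most `C + E (T n)`,
then almost sure convergence forces `E (T n)` to stay bounded: otherwise
`E (T n / E (T n) - 1) ^ 2 → 0`, while `T n / E (T n) → 0` almost surely, against Fatou's lemma. -/
theorem summable_integral_of_ae_summable {φ : ℕ → Ω → ℝ} (hL : ∀ i, MemLp (φ i) 2 μ)
    (h0 : ∀ i ω, 0 ≤ φ i ω) {C : ℝ}
    (hvar : ∀ n, Var[fun ω => ∑ i ∈ Finset.range n, φ i ω; μ]
      ≤ C + ∑ i ∈ Finset.range n, ∫ ω, φ i ω ∂μ)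
    (hφ : ∀ᵐ ω ∂μ, Summable fun i => φ i ω) : Summable fun i => ∫ ω, φ i ω ∂μ := by
  by_contra hns
  set a : ℕ → ℝ := fun n => ∑ i ∈ Finset.range n, ∫ ω, φ i ω ∂μ with ha
  have ha' : Tendsto a atTop atTop :=
    (not_summable_iff_tendsto_nat_atTop_of_nonneg fun i => integral_nonneg (h0 i)).1 hns
  have hTL : ∀ n, MemLp (fun ω => ∑ i ∈ Finset.range n, φ i ω) 2 μ := fun n =>
    memLp_finsetSum _ fun i _ => hL i
  have hmean : ∀ n, ∫ ω, ∑ i ∈ Finset.range n, φ i ω ∂μ = a n := fun n =>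
    integral_finsetSum _ fun i _ => (hL i).integrable (by simp)
  let U : ℕ → Ω → ℝ := fun n ω => ((∑ i ∈ Finset.range n, φ i ω) / a n - 1) ^ 2
  have hU : ∀ n, Integrable (U n) μ := fun n =>
    (((hTL n).mul_const (a n)⁻¹).sub (memLp_const 1)).integrable_sq
  have hint : ∀ᶠ n in atTop, ∫ ω, U n ω ∂μ ≤ (C / a n + 1) / a n := by
    filter_upwards [ha'.eventually_gt_atTop 0] with n hn
    have e : ∀ ω, U n ω = (∑ i ∈ Finset.range n, φ i ω - a n) ^ 2 / a n ^ 2 := fun ω => by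
      simp only [U]; field_simp
    simp_rw [e]
    rw [integral_div, ← hmean n, ← variance_eq_integral (hTL n).aemeasurable, hmean n,
      div_le_iff₀ (by positivity)]
    refine (hvar n).trans (le_of_eq ?_)
    change C + a n = _
    field_simp
  have hlim : Tendsto (fun n => ∫⁻ ω, ENNReal.ofReal (U n ω) ∂μ) atTop (𝓝 0) := by
    simp_rw [fun n => ((ofReal_integral_eq_lintegral_ofReal (hU n)
      (ae_of_all _ fun ω => sq_nonneg _)).symm :
        ∫⁻ ω, ENNReal.ofReal (U n ω) ∂μ = ENNReal.ofReal (∫ ω, U n ω ∂μ))]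
    rw [← ENNReal.ofReal_zero]
    refine ENNReal.tendsto_ofReal (squeeze_zero' (.of_forall fun n =>
      integral_nonneg fun ω => sq_nonneg _) hint ?_)
    exact ((ha'.const_div_atTop C).add_const 1).div_atTop ha'
  have hfatou := lintegral_liminf_le' (u := atTop) fun n => (hU n).aemeasurable.ennreal_ofReal
  rw [hlim.liminf_eq] at hfatou
  have hone : ∀ᵐ ω ∂μ, liminf (fun n => ENNReal.ofReal (U n ω)) atTop = 1 := by
    filter_upwards [hφ] with ω hω
    have h1 : Tendsto (fun n => U n ω) atTop (𝓝 ((0 - 1) ^ 2)) :=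
      ((hω.hasSum.tendsto_sum_nat.div_atTop ha').sub_const 1).pow 2
    have h2 := ENNReal.tendsto_ofReal h1
    rw [h2.liminf_eq]; norm_num
  rw [lintegral_congr_ae hone] at hfatou
  simp at hfatou

/-- The part of a symmetric nonnegative kernel off the diagonal is summable if its part above the
diagonal is. -/
lemma summable_offDiag {c : ℕ → ℕ → ℝ} (hsymm : ∀ i j, c i j = c j i)
    (h : Summable fun q : {q : ℕ × ℕ // q.1 < q.2} => c q.1.1 q.1.2) :
    Summable fun q : ℕ × ℕ => if q.1 = q.2 then 0 else c q.1 q.2 := by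
  have h1 : Summable ({q : ℕ × ℕ | q.1 < q.2}.indicator fun q => c q.1 q.2) :=
    summable_subtype_iff_indicator.1 h
  have h2 := (Equiv.prodComm ℕ ℕ).summable_iff.2 h1
  refine (h1.add h2).congr fun q => ?_
  obtain ⟨i, j⟩ := q
  rcases lt_trichotomy i j with hij | rfl | hij
  · simp [Set.indicator, hij, hij.ne, hij.not_gt]
  · simp [Set.indicator]
  · simp [Set.indicator, hij, hij.ne', hij.not_gt, hsymm i j]

end BorelCantelli

/-! ### The converse: tails of the summands -/

/-- A Lipschitz substitute for the indicator of `{x ≥ b}`: it is `0` for `x ≤ b / 2`, `1` for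
`x ≥ b` and linear in between. -/
noncomputable def ramp (b x : ℝ) : ℝ := max 0 (min 1 (2 * x / b - 1))

section Converse

lemma ramp_nonneg (b x : ℝ) : 0 ≤ ramp b x := le_max_left _ _

lemma ramp_le_one (b x : ℝ) : ramp b x ≤ 1 := max_le zero_le_one (min_le_left _ _)

lemma monotone_ramp {b : ℝ} (hb : 0 < b) : Monotone (ramp b) := fun x y h => by
  unfold ramp; gcongr

lemma ramp_eq_one {b x : ℝ} (hb : 0 < b) (h : b ≤ x) : ramp b x = 1 := by
  have : 1 ≤ 2 * x / b - 1 := by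
    have : 2 ≤ 2 * x / b := by rw [le_div_iff₀ hb]; linarith
    linarith
  rw [ramp, min_eq_left this, max_eq_right zero_le_one]

lemma ramp_eq_zero {b x : ℝ} (h : x / b < 1 / 2) : ramp b x = 0 := by
  have : 2 * x / b - 1 ≤ 0 := by rw [mul_div_assoc]; linarith
  exact max_eq_left ((min_le_right _ _).trans this)

lemma monotone_clamp_sub_ramp {b : ℝ} (hb : 0 < b) :
    Monotone ((fun x => 2 / b * clamp b x) - ramp b) := by
  have e : ((fun x => 2 / b * clamp b x) - ramp b) = fun x => max (-2) (min 1 (2 / b * x)) := by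
    funext x
    have hc : 2 / b * clamp b x = max (-2) (min 2 (2 / b * x)) := by
      have h2 : 0 ≤ 2 / b := by positivity
      have h3 : 2 / b * b = 2 := by field_simp
      rw [clamp, mul_max_of_nonneg _ _ h2, mul_min_of_nonneg _ _ h2, mul_neg, h3]
    have hr : 2 * x / b = 2 / b * x := by ring
    simp only [Pi.sub_apply]
    rw [hc, ramp, hr]
    generalize 2 / b * x = y
    rcases max_cases (-2) (min 2 y) with h | h <;> rcases min_cases 2 y with h' | h' <;>
      rcases max_cases 0 (min 1 (y - 1)) with h3 | h3 <;>
      rcases min_cases 1 (y - 1) with h4 | h4 <;>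
      rcases max_cases (-2) (min 1 y) with h5 | h5 <;> rcases min_cases 1 y with h6 | h6 <;>
      rw [h.1, h3.1, h5.1] <;> linarith
  rw [e]
  intro x y h
  dsimp only
  gcongr

variable {Ω : Type*} [MeasurableSpace Ω] {μ : Measure Ω} [IsProbabilityMeasure μ] {X : ℕ → Ω → ℝ}
  {b : ℕ → ℝ}

/-- If `X k / b k → 0` almost surely, then `∑ P (X k ≥ b k)` converges, in the form of the larger
expectations of the ramps. By association the covariances of the ramps are dominated by those of
the truncated variables. -/
theorem summable_integral_ramp (hX : IsAssociatedSeq X μ) (hXm : ∀ k, AEMeasurable (X k) μ)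
    (hb : ∀ k, 0 < b k)
    (hsum : Summable fun q : {q : ℕ × ℕ // q.1 < q.2} =>
      cov[fun ω => clamp (b q.1.1) (X q.1.1 ω), fun ω => clamp (b q.1.2) (X q.1.2 ω); μ]
        / (b q.1.1 * b q.1.2))
    (hlim : ∀ᵐ ω ∂μ, Tendsto (fun k => X k ω / b k) atTop (𝓝 0)) :
    Summable fun k => ∫ ω, ramp (b k) (X k ω) ∂μ := by
  have hL : ∀ k, MemLp (fun ω => ramp (b k) (X k ω)) 2 μ := fun k =>
    MemLp.of_bound ((monotone_ramp (hb k)).measurable.comp_aemeasurable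
      (hXm k)).aestronglyMeasurable 1 (ae_of_all _ fun ω => by
        rw [Real.norm_eq_abs, abs_of_nonneg (ramp_nonneg _ _)]; exact ramp_le_one _ _)
  have hcL : ∀ k, MemLp (fun ω => clamp (b k) (X k ω)) 2 μ := fun k =>
    memLp_clamp (hXm k) (hb k).le 2
  set c : ℕ → ℕ → ℝ := fun i j =>
    cov[fun ω => clamp (b i) (X i ω), fun ω => clamp (b j) (X j ω); μ] / (b i * b j) with hc
  have hoff := summable_offDiag (c := c)
    (fun i j => by simp only [hc]; rw [covariance_comm, mul_comm]) hsum
  have hcov : ∀ i j, cov[fun ω => ramp (b i) (X i ω), fun ω => ramp (b j) (X j ω); μ]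
      ≤ 4 * c i j := by
    intro i j
    have hmono : ∀ k, Monotone fun x => 2 / b k * clamp (b k) x := fun k =>
      (monotone_clamp _).const_mul (div_pos two_pos (hb k)).le
    refine (hX.covariance_le_covariance i j (monotone_ramp (hb i)) (hmono j)
      (monotone_clamp_sub_ramp (hb i)) (monotone_clamp_sub_ramp (hb j)) (hL i) (hL j)
      ((hcL i).const_mul _) ((hcL j).const_mul _)).trans (le_of_eq ?_)
    rw [covariance_const_mul_left, covariance_const_mul_right]
    simp only [hc]
    have := (hb i).ne'
    have := (hb j).ne'
    field_simp
    ring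
  have hc0 : ∀ i j, 0 ≤ c i j := by
    intro i j
    have hconst : ∀ x : ℝ, MemLp (fun _ : Ω => x) 2 μ := fun x => memLp_const x
    have h := hX.covariance_le_covariance (f := fun _ => 0) (g := fun _ => 0) i j monotone_const
      (monotone_clamp (b j)) (by simpa [Pi.sub_def] using monotone_clamp (b i))
      (by simpa [Pi.sub_def] using monotone_clamp (b j)) (hconst 0) (hconst 0) (hcL i) (hcL j)
    rw [covariance_const_left] at h
    exact div_nonneg h (mul_pos (hb i) (hb j)).le
  refine summable_integral_of_ae_summable hL (fun k ω => ramp_nonneg _ _)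
    (C := 4 * ∑' q : ℕ × ℕ, if q.1 = q.2 then 0 else c q.1 q.2) (fun n => ?_) ?_
  · rw [variance_fun_sum' fun i _ => hL i]
    have hterm : ∀ i j, cov[fun ω => ramp (b i) (X i ω), fun ω => ramp (b j) (X j ω); μ]
        ≤ 4 * (if i = j then 0 else c i j) + if i = j then ∫ ω, ramp (b i) (X i ω) ∂μ else 0 := by
      intro i j
      split_ifs with hij
      · subst hij
        rw [covariance_self (hL i).aemeasurable, mul_zero, zero_add]
        refine (variance_le_expectation_sq (hL i).aestronglyMeasurable).trans ?_
        refine integral_mono (hL i).integrable_sq ((hL i).integrable (by simp)) fun ω => ?_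
        have h1 := ramp_nonneg (b i) (X i ω)
        have h2 := ramp_le_one (b i) (X i ω)
        simp only [Pi.pow_apply]
        nlinarith
      · simpa using hcov i j
    refine (Finset.sum_le_sum fun i _ => Finset.sum_le_sum fun j _ => hterm i j).trans ?_
    simp_rw [Finset.sum_add_distrib, ← Finset.mul_sum]
    refine add_le_add (mul_le_mul_of_nonneg_left ?_ (by norm_num)) (le_of_eq ?_)
    · rw [← Finset.sum_product']
      exact hoff.sum_le_tsum _ fun q _ => by split_ifs <;> simp [hc0]
    · refine Finset.sum_congr rfl fun i hi => ?_
      rw [Finset.sum_ite_eq, if_pos hi]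
  · filter_upwards [hlim] with ω hω
    obtain ⟨N, hN⟩ := eventually_atTop.1 (hω.eventually_lt_const (by norm_num : (0 : ℝ) < 1 / 2))
    refine summable_of_ne_finset_zero (s := Finset.range N) fun k hk => ramp_eq_zero (hN k ?_)
    simpa using hk

end Converse

/-! ### The strong law and its converse -/

section StrongLaw

variable {Ω : Type*} [MeasurableSpace Ω] {μ : Measure Ω} {p : ℝ} {X : ℕ → Ω → ℝ}

lemma clamp_neg {u : ℝ} (hu : 0 ≤ u) (x : ℝ) : clamp u (-x) = -clamp u x := by
  unfold clamp
  rcases max_cases (-u) (min u x) with h | h <;> rcases min_cases u x with h' | h' <;>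
    rcases max_cases (-u) (min u (-x)) with h2 | h2 <;>
    rcases min_cases u (-x) with h3 | h3 <;> rw [h.1, h2.1] <;> linarith

/-- Successive differences of the normalized sums show that the single summands are negligible. -/
lemma SatisfiesSLLN.ae_tendsto_div_rootSeq (hp1 : 1 ≤ p) {c : ℝ} (h : SatisfiesSLLN X μ p c) :
    ∀ᵐ ω ∂μ, Tendsto (fun k => X k ω / rootSeq p k) atTop (𝓝 0) := by
  filter_upwards [h] with ω hω
  have h1 := hω.comp (tendsto_add_atTop_nat 1)
  have h2 : Tendsto (fun n : ℕ => (∑ k ∈ Finset.range n, (X k ω - c)) / rootSeq p n)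
      atTop (𝓝 0) := by
    refine squeeze_zero_norm' ?_ (by simpa only [abs_zero] using hω.abs)
    filter_upwards [eventually_gt_atTop 0] with n hn
    have hn' : (0 : ℝ) < n := by exact_mod_cast hn
    rw [Real.norm_eq_abs, abs_div, abs_div, abs_of_pos (rootSeq_pos p n),
      abs_of_nonneg (by positivity : (0 : ℝ) ≤ (n : ℝ) ^ (1 / p))]
    refine div_le_div_of_nonneg_left (abs_nonneg _) (by positivity) ?_
    exact Real.rpow_le_rpow hn'.le (by push_cast; linarith) (by positivity)
  have h3 := (h1.sub h2).add ((tendsto_rootSeq_atTop hp1).const_div_atTop c)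
  simp only [sub_zero, add_zero] at h3
  refine h3.congr fun n => ?_
  simp only [Function.comp_apply]
  rw [← rootSeq, Finset.sum_range_succ]
  ring

variable [IsProbabilityMeasure μ]

lemma CovarianceCondition.summable_covariance_clamp (hX : ∀ k, AEMeasurable (X k) μ)
    (h : CovarianceCondition X μ p) :
    Summable fun q : {q : ℕ × ℕ // q.1 < q.2} =>
      cov[fun ω => clamp (rootSeq p q.1.1) (X q.1.1 ω),
        fun ω => clamp (rootSeq p q.1.2) (X q.1.2 ω); μ]
        / (rootSeq p q.1.1 * rootSeq p q.1.2) := by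
  refine Summable.congr h fun q => ?_
  rw [← rootSeq, ← rootSeq, truncCov_eq_covariance (hX _) (hX _) (rootSeq_pos p _).le
    (rootSeq_pos p _).le, Real.rpow_neg (by positivity), Real.mul_rpow (by positivity)
    (by positivity), ← rootSeq, ← rootSeq, div_eq_inv_mul]

theorem SatisfiesSLLN.integrable_abs_rpow (hp1 : 1 ≤ p)
    (hident : ∀ n, IdentDistrib (X n) (X 0) μ μ) (hassoc : IsAssociatedSeq X μ)
    (hcov : CovarianceCondition X μ p) {c : ℝ} (h : SatisfiesSLLN X μ p c) :
    Integrable (fun ω => |X 0 ω| ^ p) μ := by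
  have hXm : ∀ k, AEMeasurable (X k) μ := fun k => (hident k).aemeasurable_fst
  have hb := rootSeq_pos p
  have hsum := hcov.summable_covariance_clamp hXm
  have hlim := h.ae_tendsto_div_rootSeq hp1
  have hpos := summable_integral_ramp hassoc hXm hb hsum hlim
  have hneg := summable_integral_ramp (X := fun k ω => -X k ω) hassoc.neg (fun k => (hXm k).neg) hb
    (by
      refine hsum.congr fun q => ?_
      simp_rw [clamp_neg (hb _).le]
      rw [covariance_fun_neg_left, covariance_fun_neg_right, neg_neg])
    (by
      filter_upwards [hlim] with ω hω
      simpa [neg_div] using hω.neg)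
  -- The tail probability is at most the expectation of the ramp.
  have tail : ∀ (Y : ℕ → Ω → ℝ), (∀ k, IdentDistrib (Y k) (Y 0) μ μ) → ∀ k,
      μ {ω | rootSeq p k ≤ Y 0 ω} ≤ ENNReal.ofReal (∫ ω, ramp (rootSeq p k) (Y k ω) ∂μ) := by
    intro Y hY k
    have hm := (monotone_ramp (hb k)).measurable.comp_aemeasurable (hY k).aemeasurable_fst
    have hint : Integrable (fun ω => ramp (rootSeq p k) (Y k ω)) μ :=
      Integrable.of_bound hm.aestronglyMeasurable 1 (ae_of_all _ fun ω => by
        rw [Real.norm_eq_abs, abs_of_nonneg (ramp_nonneg _ _)]; exact ramp_le_one _ _)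
    have e : μ {ω | rootSeq p k ≤ Y 0 ω} = μ {ω | rootSeq p k ≤ Y k ω} :=
      ((hY k).measure_mem_eq (s := Set.Ici (rootSeq p k)) measurableSet_Ici).symm
    rw [e, ofReal_integral_eq_lintegral_ofReal hint (ae_of_all _ fun ω => ramp_nonneg _ _)]
    have hmarkov := mul_meas_ge_le_lintegral₀ hm.ennreal_ofReal 1
    rw [one_mul] at hmarkov
    refine le_trans (measure_mono fun ω hω => ?_) hmarkov
    simp only [Set.mem_ofPred_eq, Function.comp_apply] at hω ⊢
    rw [ramp_eq_one (hb k) hω, ENNReal.ofReal_one]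
  have hTm : AEMeasurable (fun ω => |X 0 ω| ^ p) μ := by
    have := hXm 0
    fun_prop
  rw [integrable_iff_tsum_measure_natCast_le_ne_top hTm fun ω => by positivity]
  refine ne_top_of_le_ne_top (hpos.add hneg).tsum_ofReal_ne_top (ENNReal.tsum_le_tsum fun k => ?_)
  rw [ENNReal.ofReal_add (integral_nonneg fun ω => ramp_nonneg _ _)
    (integral_nonneg fun ω => ramp_nonneg _ _)]
  refine le_trans (le_trans (measure_mono fun ω hω => ?_) (measure_union_le _ _))
    (add_le_add (tail X hident k) (tail (fun k ω => -X k ω) (fun k => (hident k).neg) k))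
  have hω' := (rootSeq_le_iff hp1 k (abs_nonneg _)).2 hω
  exact le_abs.1 hω'

/-- Borel–Cantelli: almost surely, only finitely many variables are changed by the truncation. -/
lemma ae_eventually_clamp_eq (hp1 : 1 ≤ p) (hident : ∀ n, IdentDistrib (X n) (X 0) μ μ)
    (hint : Integrable (fun ω => |X 0 ω| ^ p) μ) :
    ∀ᵐ ω ∂μ, ∀ᶠ k in atTop, clamp (rootSeq p k) (X k ω) = X k ω := by
  have h1 := (integrable_iff_tsum_measure_natCast_le_ne_top hint.aemeasurable
    fun ω => by positivity).1 hint
  have e : ∀ k : ℕ, μ {ω | ((k + 1 : ℕ) : ℝ) ≤ |X 0 ω| ^ p}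
      = μ {ω | ((k + 1 : ℕ) : ℝ) ≤ |X k ω| ^ p} := fun k =>
    ((hident k).measure_mem_eq (s := {x | ((k + 1 : ℕ) : ℝ) ≤ |x| ^ p})
      (measurableSet_le measurable_const (by fun_prop))).symm
  simp_rw [e] at h1
  filter_upwards [ae_eventually_notMem h1] with ω hω
  filter_upwards [hω] with k hk
  refine clamp_of_abs_le (le_of_not_ge fun h => hk ?_)
  exact (rootSeq_le_iff hp1 k (abs_nonneg _)).1 h

/-- The truncated means are close enough to the mean, by dominated convergence. -/
lemma tendsto_sum_integral_clamp_sub_div (hp1 : 1 ≤ p)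
    (hident : ∀ n, IdentDistrib (X n) (X 0) μ μ) (hX0 : Integrable (X 0) μ)
    (hint : Integrable (fun ω => |X 0 ω| ^ p) μ) :
    Tendsto (fun n : ℕ => (∑ k ∈ Finset.range n,
      (∫ ω, clamp (rootSeq p k) (X k ω) ∂μ - ∫ ω, X 0 ω ∂μ)) / (n : ℝ) ^ (1 / p))
      atTop (𝓝 0) := by
  have hXm := hX0.aemeasurable
  have hm : ∀ k, Integrable (fun ω => max (|X 0 ω| - rootSeq p k) 0) μ := fun k =>
    (hX0.abs.sub (integrable_const _)).pos_part
  have hD : Tendsto (fun n : ℕ => ∫ ω, (∑ k ∈ Finset.range n, max (|X 0 ω| - rootSeq p k) 0)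
      / (n : ℝ) ^ (1 / p) ∂μ) atTop (𝓝 (∫ _, (0 : ℝ) ∂μ)) := by
    refine tendsto_integral_of_dominated_convergence _ (fun n => ?_) hint (fun n => ?_) ?_
    · exact ((integrable_finsetSum _ fun k _ => hm k).div_const _).aestronglyMeasurable
    · refine ae_of_all _ fun ω => ?_
      rw [Real.norm_of_nonneg (by positivity)]
      exact sum_max_sub_rootSeq_div_le hp1 (abs_nonneg _) n
    · exact ae_of_all _ fun ω => tendsto_sum_max_sub_rootSeq_div hp1 (abs_nonneg _)
  rw [integral_zero] at hD
  refine squeeze_zero_norm (fun n => ?_) hD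
  rw [integral_div, integral_finsetSum _ fun k _ => hm k, norm_div,
    Real.norm_of_nonneg (by positivity : (0 : ℝ) ≤ (n : ℝ) ^ (1 / p))]
  refine div_le_div_of_nonneg_right ((norm_sum_le _ _).trans
    (Finset.sum_le_sum fun k _ => ?_)) (by positivity)
  have e : ∫ ω, clamp (rootSeq p k) (X k ω) ∂μ = ∫ ω, clamp (rootSeq p k) (X 0 ω) ∂μ :=
    ((hident k).comp (monotone_clamp _).measurable).integral_eq
  have hc := (memLp_clamp hXm (rootSeq_pos p k).le 1).integrable le_rfl
  rw [e, ← integral_sub hc hX0]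
  refine (norm_integral_le_integral_norm _).trans
    (integral_mono (hc.sub hX0).norm (hm k) fun ω => ?_)
  simp only [Real.norm_eq_abs]
  rw [abs_sub_comm]
  exact abs_sub_clamp_le (rootSeq_pos p k).le _

/-- The normalized truncated second moments are summable. This is where `p < 2` enters. -/
lemma summable_variance_clamp_div (hp1 : 1 ≤ p) (hp2 : p < 2)
    (hident : ∀ n, IdentDistrib (X n) (X 0) μ μ)
    (hint : Integrable (fun ω => |X 0 ω| ^ p) μ) :
    Summable fun k => Var[fun ω => clamp (rootSeq p k) (X k ω); μ] / rootSeq p k ^ 2 := by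
  have hXm : ∀ k, AEMeasurable (X k) μ := fun k => (hident k).aemeasurable_fst
  have hb := rootSeq_pos p
  have hr : 1 < 2 / p := by rw [lt_div_iff₀ (by linarith)]; linarith
  have hL : ∀ k, MemLp (fun ω => clamp (rootSeq p k) (X 0 ω)) 2 μ := fun k =>
    memLp_clamp (hXm 0) (hb k).le 2
  have hsq : ∀ k, Integrable (fun ω => (clamp (rootSeq p k) (X 0 ω) / rootSeq p k) ^ 2) μ :=
    fun k => ((hL k).mul_const (rootSeq p k)⁻¹).integrable_sq
  have hdom : Integrable (fun ω => (2 + 1 / (2 / p - 1)) * max (|X 0 ω| ^ p) 1) μ :=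
    (hint.sup (integrable_const 1)).const_mul _
  have hle : ∀ k, Var[fun ω => clamp (rootSeq p k) (X k ω); μ] / rootSeq p k ^ 2
      ≤ ∫ ω, (clamp (rootSeq p k) (X 0 ω) / rootSeq p k) ^ 2 ∂μ := by
    intro k
    have e : Var[fun ω => clamp (rootSeq p k) (X k ω); μ]
        = Var[fun ω => clamp (rootSeq p k) (X 0 ω); μ] :=
      ((hident k).comp (monotone_clamp _).measurable).variance_eq
    simp_rw [div_pow]
    rw [integral_div, e]
    exact div_le_div_of_nonneg_right (variance_le_expectation_sq (hL k).aestronglyMeasurable)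
      (by positivity)
  refine Summable.of_nonneg_of_le (fun k => div_nonneg (variance_nonneg _ _) (by positivity)) hle
    (summable_of_sum_range_le (c := ∫ ω, (2 + 1 / (2 / p - 1)) * max (|X 0 ω| ^ p) 1 ∂μ)
      (fun k => integral_nonneg fun ω => sq_nonneg _) fun n => ?_)
  rw [← integral_finsetSum _ fun k _ => hsq k]
  refine integral_mono (integrable_finsetSum _ fun k _ => hsq k) hdom fun ω => ?_
  exact (Finset.sum_le_sum fun k _ => clamp_div_rootSeq_sq_le hp1 k (X 0 ω)).trans
    (sum_min_div_rpow_le hr (by positivity) n)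

/-- The strong law for the truncated variables. -/
lemma ae_tendsto_sum_clamp_sub_div (hp1 : 1 ≤ p) (hp2 : p < 2)
    (hident : ∀ n, IdentDistrib (X n) (X 0) μ μ) (hassoc : IsAssociatedSeq X μ)
    (hcov : CovarianceCondition X μ p) (hint : Integrable (fun ω => |X 0 ω| ^ p) μ) :
    ∀ᵐ ω ∂μ, Tendsto (fun n : ℕ => (∑ k ∈ Finset.range n,
      (clamp (rootSeq p k) (X k ω) - ∫ ω, clamp (rootSeq p k) (X k ω) ∂μ)) / (n : ℝ) ^ (1 / p))
      atTop (𝓝 0) := by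
  have hXm : ∀ k, AEMeasurable (X k) μ := fun k => (hident k).aemeasurable_fst
  have hb := rootSeq_pos p
  set Y : ℕ → Ω → ℝ := fun k ω => clamp (rootSeq p k) (X k ω) with hY
  have hYL : ∀ k, MemLp (Y k) 2 μ := fun k => memLp_clamp (hXm k) (hb k).le 2
  have hYi : ∀ k, Integrable (Y k) μ := fun k => (hYL k).integrable (by simp)
  set Z : ℕ → Ω → ℝ := fun k ω => (Y k ω - ∫ ω, Y k ω ∂μ) / rootSeq p k with hZ
  have hZa : IsAssociatedSeq Z μ := hassoc.comp
    (φ := fun k x => (clamp (rootSeq p k) x - ∫ ω, Y k ω ∂μ) / rootSeq p k) fun k x y h =>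
      div_le_div_of_nonneg_right (sub_le_sub_right (monotone_clamp _ h) _) (hb k).le
  have hZL : ∀ k, MemLp (Z k) 2 μ := fun k => by
    simpa only [hZ, div_eq_mul_inv, Pi.sub_apply] using
      ((hYL k).sub (memLp_const _)).mul_const (rootSeq p k)⁻¹
  have hZ0 : ∀ k, ∫ ω, Z k ω ∂μ = 0 := fun k => by
    simp only [hZ]
    rw [integral_div, integral_sub (hYi k) (integrable_const _)]
    simp
  have hZc : ∀ i j, cov[Z i, Z j; μ] = cov[Y i, Y j; μ] / (rootSeq p i * rootSeq p j) := by
    intro i j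
    simp only [hZ]
    rw [covariance_fun_div_left, covariance_fun_div_right, covariance_sub_const_left (hYi i),
      covariance_sub_const_right (hYi j), div_div, mul_comm (rootSeq p j)]
  have hoff := summable_offDiag
    (c := fun i j => cov[Y i, Y j; μ] / (rootSeq p i * rootSeq p j))
    (fun i j => by rw [covariance_comm, mul_comm]) (hcov.summable_covariance_clamp hXm)
  have hdiag : Summable fun q : ℕ × ℕ =>
      if q.1 = q.2 then Var[Y q.1; μ] / rootSeq p q.1 ^ 2 else 0 := by
    have hinj : Function.Injective fun i : ℕ => (i, i) := fun i j h => congrArg Prod.fst h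
    rw [← hinj.summable_iff]
    · simpa [Function.comp_def] using summable_variance_clamp_div hp1 hp2 hident hint
    · rintro ⟨i, j⟩ hq
      exact if_neg fun h : i = j => hq ⟨i, by simp [h]⟩
  have hsum : Summable fun q : ℕ × ℕ => cov[Z q.1, Z q.2; μ] := by
    refine (hoff.add hdiag).congr fun q => ?_
    obtain ⟨i, j⟩ := q
    rw [hZc]
    by_cases hij : i = j
    · subst hij
      simp [covariance_self (hYL i).aemeasurable, sq]
    · simp [hij]
  filter_upwards [ae_exists_tendsto_sum_of_summable_covariance hZa hZL hZ0 hsum] with ω ⟨l, hl⟩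
  have hmono : Monotone fun n : ℕ => (n : ℝ) ^ (1 / p) := fun m n h =>
    Real.rpow_le_rpow (by positivity) (by exact_mod_cast h) (by positivity)
  refine (tendsto_sum_mul_div_of_tendsto_sum hmono (tendsto_natCast_rpow_one_div_atTop hp1)
    hl).congr fun n => ?_
  congr 1
  refine Finset.sum_congr rfl fun k _ => ?_
  change rootSeq p k * ((Y k ω - ∫ ω, Y k ω ∂μ) / rootSeq p k) = _
  rw [mul_div_cancel₀ _ (hb k).ne']

theorem satisfiesSLLN_of_integrable_abs_rpow (hp1 : 1 ≤ p) (hp2 : p < 2)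
    (hident : ∀ n, IdentDistrib (X n) (X 0) μ μ) (hassoc : IsAssociatedSeq X μ)
    (hcov : CovarianceCondition X μ p) (hX0 : Integrable (X 0) μ)
    (hint : Integrable (fun ω => |X 0 ω| ^ p) μ) :
    SatisfiesSLLN X μ p (∫ ω, X 0 ω ∂μ) := by
  filter_upwards [ae_eventually_clamp_eq hp1 hident hint,
    ae_tendsto_sum_clamp_sub_div hp1 hp2 hident hassoc hcov hint] with ω h1 h2
  have h3 := tendsto_sum_integral_clamp_sub_div hp1 hident hX0 hint
  obtain ⟨N, hN⟩ := eventually_atTop.1 h1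
  have hs : Summable fun k => X k ω - clamp (rootSeq p k) (X k ω) :=
    summable_of_ne_finset_zero (s := Finset.range N) fun k hk => by
      rw [hN k (by simpa using hk), sub_self]
  have h4 := hs.hasSum.tendsto_sum_nat.div_atTop (tendsto_natCast_rpow_one_div_atTop hp1)
  have h5 := (h4.add h2).add h3
  simp only [add_zero] at h5
  refine h5.congr fun n => ?_
  rw [← add_div, ← add_div, ← Finset.sum_add_distrib, ← Finset.sum_add_distrib]
  congr 1
  exact Finset.sum_congr rfl fun k _ => by ring

end StrongLaw

theorem corollary1 {Ω : Type*} [MeasurableSpace Ω] (μ : Measure Ω) [IsProbabilityMeasure μ]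
    (p : ℝ) (hp1 : 1 ≤ p) (hp2 : p < 2) (X : ℕ → Ω → ℝ)
    (hident : ∀ n, IdentDistrib (X n) (X 0) μ μ)
    (hassoc : IsAssociatedSeq X μ)
    (hcov : CovarianceCondition X μ p) :
    (Integrable (fun ω => |X 0 ω| ^ p) μ ↔
      Integrable (X 0) μ ∧ SatisfiesSLLN X μ p (∫ ω, X 0 ω ∂μ)) ∧
    (∀ c : ℝ, SatisfiesSLLN X μ p c → Integrable (fun ω => |X 0 ω| ^ p) μ) := by
  have hconv : ∀ c : ℝ, SatisfiesSLLN X μ p c → Integrable (fun ω => |X 0 ω| ^ p) μ := fun c h =>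
    h.integrable_abs_rpow hp1 hident hassoc hcov
  refine ⟨⟨fun hint => ?_, fun h => hconv _ h.2⟩, hconv⟩
  have hX0 : Integrable (X 0) μ := by
    have hm := (hident 0).aemeasurable_fst.aestronglyMeasurable
    refine (hint.add (integrable_const 1)).mono' hm (ae_of_all _ fun ω => ?_)
    simp only [Pi.add_apply, Real.norm_eq_abs]
    rcases le_total |X 0 ω| 1 with h | h
    · have : 0 ≤ |X 0 ω| ^ p := by positivity
      linarith
    · have := Real.self_le_rpow_of_one_le h hp1
      linarith
  exact ⟨hX0, satisfiesSLLN_of_integrable_abs_rpow hp1 hp2 hident hassoc hcov hX0 hint⟩
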